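/- Let $m\ge 2$ and let $G$ be an $m$-uniform hypergraph with finite node set $V(G)=\{x_1,\dots,x_n\}$ and edge set $E(G)$, i.e. $E(G)$ is a set of $m$-element subsets of $V(G)$. Assume that $G$ has no isolated nodes (every node lies in some edge). The connected components of $G$ are the classes of nodes under the relation of being joined by a sequence of edges in which consecutive edges have a common node (the first edge containing one node and the last edge the other), each component carrying the edges of $G$ contained in it. Assume that each component is properly connected: for any two edges $u,v$ of the component there is a sequence of edges of the component starting with $u$ and ending with $v$ such that the intersection of any two consecutive edges has size $m-1$. For nodes $x_i,x_j$ write $x_i\approx x_j$ if there is a set $A\subset V(G)\setminus\{x_i,x_j\}$ such that $\{x_i\}\cup A$ and $\{x_j\}\cup A$ are edges of $G$; pivot equivalence is the equivalence relation on $V(G)$ generated by $\approx$. Let $k$ be a field, let $R=k[x_1,\dots,x_n]_{(x_1,\dots,x_n)}$ with maximal ideal $\mathfrak m$, and let $I(G)\subset R$ be the edge ideal, generated by the monomials $x_{i_1}\cdots x_{i_m}$ with $\{x_{i_1},\dots,x_{i_m}\}\in E(G)$. The analytic spread $\ell(I)$ of an ideal $I\subset R$ is the Krull dimension of the special fiber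 ring $\mathcal G/\mathfrak m\mathcal G$, where $\mathcal G=\bigoplus_{j\ge 0} I^j/I^{j+1}$ is the associated graded ring of $R$ with respect to $I$. **Proposition 6.1.** If $G$ has $c$ connected components and $p$ pivot equivalence classes, then $$\ell(I(G)) = n-p+c.$$ -/

import Mathlib

noncomputable section

/-! ### Analytic spread of an ideal in a local ring -/

/-- The associated graded ring `𝒢 = ⨁ₖ Iᵏ / Iᵏ⁺¹` of `R` with respect to `I`, realised as the
quotient `ℛ / Iℛ` of the Rees algebra `ℛ = R[It] = ⨁ₖ Iᵏ tᵏ` (in degree `k`, the ideal `Iℛ` is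
`I · Iᵏ = Iᵏ⁺¹`). -/
def Ideal.AssocGradedRing {R : Type*} [CommRing R] (I : Ideal R) : Type _ :=
  reesAlgebra I ⧸ I.map (algebraMap R (reesAlgebra I))

instance Ideal.AssocGradedRing.instCommRing {R : Type*} [CommRing R] (I : Ideal R) :
    CommRing I.AssocGradedRing :=
  Ideal.Quotient.commRing (I.map (algebraMap R (reesAlgebra I)))

instance Ideal.AssocGradedRing.instAlgebra {R : Type*} [CommRing R] (I : Ideal R) :
    Algebra R I.AssocGradedRing :=
  Ideal.Quotient.algebra R (I := I.map (algebraMap R (reesAlgebra I)))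

/-- The special fiber ring `𝒢 / 𝔪𝒢` of an ideal `I` in a local ring `(R, 𝔪)`. -/
def Ideal.SpecialFiberRing {R : Type*} [CommRing R] [IsLocalRing R] (I : Ideal R) : Type _ :=
  I.AssocGradedRing ⧸ (IsLocalRing.maximalIdeal R).map (algebraMap R I.AssocGradedRing)

instance Ideal.SpecialFiberRing.instCommRing {R : Type*} [CommRing R] [IsLocalRing R]
    (I : Ideal R) : CommRing I.SpecialFiberRing :=
  Ideal.Quotient.commRing
    ((IsLocalRing.maximalIdeal R).map (algebraMap R I.AssocGradedRing))

/-- The analytic spread `ℓ(I)`: the Krull dimension of the special fiber ring. -/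
def Ideal.analyticSpread {R : Type*} [CommRing R] [IsLocalRing R] (I : Ideal R) : WithBot ℕ∞ :=
  ringKrullDim I.SpecialFiberRing

/-! ### The local ring `k[x₁, …, xₙ]` at the origin -/

/-- The ideal `(x₁, …, xₙ)` generated by the variables is prime. -/
instance MvPolynomial.isPrime_idealOfVars (σ k : Type*) [Field k] :
    (MvPolynomial.idealOfVars σ k).IsPrime := by
  have h : MvPolynomial.idealOfVars σ k =
      RingHom.ker (MvPolynomial.constantCoeff : MvPolynomial σ k →+* k) := by
    ext f
    rw [← pow_one (MvPolynomial.idealOfVars σ k), MvPolynomial.mem_pow_idealOfVars_iff',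
      RingHom.mem_ker, MvPolynomial.constantCoeff_eq]
    constructor
    · intro hf
      exact hf 0 (by simp)
    · intro hf x hx
      rwa [(Finsupp.degree_eq_zero_iff x).1 (by omega)]
  rw [h]
  exact RingHom.ker_isPrime _

namespace Hypergraph

variable {α : Type*}

/-! ### Uniform hypergraphs, components, proper connectedness, pivot equivalence -/

/-- `G` is `m`-uniform if each edge has exactly `m` elements. -/
def IsUniform (G : Hypergraph α) (m : ℕ) : Prop :=
  ∀ e ∈ G.edgeSet, e.Finite ∧ e.ncard = m

/-- Two nodes lie in the same connected component if they are joined by a chain of nodes in which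
consecutive nodes lie in a common edge; this is the same as being equal or being joined by a
sequence of edges in which consecutive edges have a common node. -/
def connectedSetoid (G : Hypergraph α) : Setoid G.vertexSet :=
  Relation.EqvGen.setoid fun x y => G.Adj x y

/-- The (indices of the) connected components of `G`. -/
abbrev ConnectedComponent (G : Hypergraph α) : Type _ := Quotient G.connectedSetoid

/-- The connected component `C` as a hypergraph: its nodes, and the edges of `G` among them. -/
def component (G : Hypergraph α) (C : G.ConnectedComponent) : Hypergraph α where
  vertexSet := {a | ∃ x : G.vertexSet, (x : α) = a ∧ Quotient.mk G.connectedSetoid x = C}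
  edgeSet := {e | e ∈ G.edgeSet ∧
    e ⊆ {a | ∃ x : G.vertexSet, (x : α) = a ∧ Quotient.mk G.connectedSetoid x = C}}
  subset_vertexSet_of_mem_edgeSet' := fun _ he => he.2

/-- An `m`-uniform hypergraph is properly connected if any two edges are joined by a sequence of
edges in which the intersection of consecutive edges has size `m - 1`. -/
def IsProperlyConnected (G : Hypergraph α) (m : ℕ) : Prop :=
  ∀ u ∈ G.edgeSet, ∀ v ∈ G.edgeSet,
    Relation.ReflTransGen
      (fun e f : Set α => e ∈ G.edgeSet ∧ f ∈ G.edgeSet ∧ (e ∩ f).ncard + 1 = m) u v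

/-- The relation `x ≈ y`: there is a set `A` of nodes other than `x`, `y` such that `{x} ∪ A` and
`{y} ∪ A` are edges. -/
def PivotStep (G : Hypergraph α) (x y : G.vertexSet) : Prop :=
  ∃ A : Set α, A ⊆ G.vertexSet \ {(x : α), (y : α)} ∧
    {(x : α)} ∪ A ∈ G.edgeSet ∧ {(y : α)} ∪ A ∈ G.edgeSet

/-- Pivot equivalence: the equivalence relation on nodes generated by the symmetric relation `≈`. -/
def pivotSetoid (G : Hypergraph α) : Setoid G.vertexSet :=
  Relation.EqvGen.setoid G.PivotStep

/-- The pivot equivalence classes of `G`. -/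
abbrev PivotClass (G : Hypergraph α) : Type _ := Quotient G.pivotSetoid

/-! ### The edge ideal -/

/-- The local ring `k[x₁, …, xₙ]` localized at `(x₁, …, xₙ)`, one variable for each node of `G`. -/
abbrev NodeLocalRing (k : Type*) [Field k] (G : Hypergraph α) : Type _ :=
  Localization.AtPrime (MvPolynomial.idealOfVars G.vertexSet k)

/-- The square-free monomial `∏_{x ∈ e} x` of a set `e` of nodes (`G` has finitely many nodes in
all uses). -/
def edgeMonomial (k : Type*) [Field k] (G : Hypergraph α) (e : Set α) :
    MvPolynomial G.vertexSet k :=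
  ∏ᶠ (x : G.vertexSet) (_ : (x : α) ∈ e), MvPolynomial.X x

/-- The edge ideal `I(G)` in the local ring. -/
def edgeIdeal (k : Type*) [Field k] (G : Hypergraph α) : Ideal (NodeLocalRing k G) :=
  Ideal.span ((fun e => algebraMap (MvPolynomial G.vertexSet k) (NodeLocalRing k G)
    (G.edgeMonomial k e)) '' G.edgeSet)

end Hypergraph

end

noncomputable section

open Cardinal

/-! All edge monomials have the same degree `m`, so the special fiber ring of `I(G)` is the
subalgebra of `k[x₁, …, xₙ]` generated by them (`ker_toSpecialFiberRing_comp_toReesAlgebra`,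
`toSpecialFiberRing_comp_toReesAlgebra_surjective`). For this finitely generated domain, Krull
dimension equals transcendence degree, which for monomials is the rank over `ℚ` of their exponent
vectors. Hence `ℓ(I(G))` is the rank of the incidence vectors of the edges.

To compute the rank, let `π` sum the coordinates of a vector over each pivot class. Its kernel has
dimension `n - p` and is spanned by differences of pivot equivalent nodes; one pivot step is a
difference of two edge vectors, so the edge span contains `ker π`. Consecutive edges of a proper
chain differ by a pivot, so `π` is constant on the edges of a component. The `c` resulting values
are independent because components share no nodes. The rank is therefore `(n - p) + c`. -/

/-! ### Krull dimension and transcendence degree -/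

/-- Incomparability contracts chains of primes strictly; lying over and going up lift them. -/
theorem ringKrullDim_eq_of_isIntegral (R S : Type*) [CommRing R] [CommRing S] [Algebra R S]
    [Algebra.IsIntegral R S] [FaithfulSMul R S] : ringKrullDim S = ringKrullDim R := by
  refine le_antisymm ?_ ?_
  · refine Order.krullDim_le_of_strictMono (PrimeSpectrum.comap (algebraMap R S)) fun p q h => ?_
    exact Ideal.IsIntegral.comap_lt_comap (R := R) (I := p.asIdeal) (J := q.asIdeal) h
  · refine iSup_le fun l => ?_
    obtain ⟨P, hP, hlo⟩ := (inferInstance : Nonempty ((l.head).asIdeal.primesOver S))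
    obtain ⟨L, hL, -⟩ := Ideal.exists_ltSeries_of_hasGoingUp l P
    rw [← hL]
    exact Order.LTSeries.length_le_krullDim L

/-- Noether normalization: both sides equal the number of variables of the polynomial ring over
which `A` is finite. -/
theorem ringKrullDim_eq_toNat_trdeg (k A : Type*) [Field k] [CommRing A] [IsDomain A] [Algebra k A]
    [Algebra.FiniteType k A] :
    ringKrullDim A = ((Algebra.trdeg k A).toNat : WithBot ℕ∞) := by
  obtain ⟨s, g, hg, hfin⟩ := exists_finite_inj_algHom_of_fg k A
  let _ : Algebra (MvPolynomial (Fin s) k) A := g.toRingHom.toAlgebra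
  have : IsScalarTower k (MvPolynomial (Fin s) k) A :=
    IsScalarTower.of_algebraMap_eq fun r => (g.commutes r).symm
  have : Module.Finite (MvPolynomial (Fin s) k) A := hfin
  have : FaithfulSMul (MvPolynomial (Fin s) k) A :=
    (faithfulSMul_iff_algebraMap_injective _ _).mpr hg
  have hd : ringKrullDim A = (s : WithBot ℕ∞) := by
    rw [ringKrullDim_eq_of_isIntegral (MvPolynomial (Fin s) k) A]
    simp [ringKrullDim_eq_zero_of_field]
  have ht := lift_trdeg_add_eq k (MvPolynomial (Fin s) k) A
  rw [trdeg_eq_zero (R := MvPolynomial (Fin s) k) (A := A)] at ht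
  simp only [MvPolynomial.trdeg_of_isDomain, mk_fin, lift_natCast, lift_zero, add_zero] at ht
  have h2 := congrArg Cardinal.toNat ht
  simp only [toNat_natCast, toNat_lift] at h2
  rw [hd, h2]

/-! ### Transcendence degree of monomial subalgebras -/

namespace MvPolynomial

/-- The rational vector underlying an exponent vector. -/
def exponentVec {σ : Type*} : (σ →₀ ℕ) →ₗ[ℕ] (σ →₀ ℚ) :=
  Finsupp.mapRange.linearMap (Algebra.linearMap ℕ ℚ)

@[simp]
theorem exponentVec_apply {σ : Type*} (s : σ →₀ ℕ) (x : σ) : exponentVec s x = s x := by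
  simp [exponentVec]

theorem linearIndependent_exponentVec_iff {ι σ : Type*} [Finite ι] (d : ι → σ →₀ ℕ) :
    LinearIndependent ℚ (fun i => exponentVec (d i)) ↔ LinearIndependent ℕ d := by
  refine ⟨fun h => ?_, fun h => ?_⟩
  · exact (h.restrict_scalars' ℕ).of_comp exponentVec
  · have := Fintype.ofFinite ι
    rw [← LinearIndependent.iff_fractionRing ℤ ℚ, Fintype.linearIndependent_iff]
    intro g hg i
    -- An integer relation is split into its positive and negative parts, giving two natural
    -- combinations with the same value.
    have key : Finsupp.equivFunOnFinite.symm (fun i => (g i).toNat) =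
        Finsupp.equivFunOnFinite.symm (fun i => (-g i).toNat) := by
      apply h
      simp only [Finsupp.linearCombination_apply, Finsupp.sum_fintype, zero_smul, implies_true,
        Finsupp.equivFunOnFinite_symm_apply_apply]
      ext x
      have hx := DFunLike.congr_fun hg x
      simp only [Finsupp.finsetSum_apply, Finsupp.smul_apply, exponentVec_apply, zsmul_eq_mul,
        Finsupp.zero_apply] at hx
      have hx' : ∑ j, g j * (d j x : ℤ) = 0 := by exact_mod_cast hx
      simp only [Finsupp.finsetSum_apply, Finsupp.smul_apply, smul_eq_mul]
      zify
      rw [← sub_eq_zero, ← Finset.sum_sub_distrib, ← hx']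
      refine Finset.sum_congr rfl fun j _ => ?_
      rw [← sub_mul]
      congr 1
      exact Int.toNat_sub_toNat_neg (g j)
    have hi := DFunLike.congr_fun key i
    simp only [Finsupp.equivFunOnFinite_symm_apply_apply] at hi
    omega

theorem aeval_monomial_one_monomial {ι σ k : Type*} [Field k] (d : ι → σ →₀ ℕ) (s : ι →₀ ℕ) (c : k) :
    aeval (fun i => monomial (d i) (1 : k)) (monomial s c) =
      monomial (Finsupp.linearCombination ℕ d s) c := by
  rw [aeval_monomial, Finsupp.linearCombination_apply, Finsupp.sum, Finsupp.prod]
  simp only [monomial_pow, one_pow]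
  rw [← monomial_sum_one, algebraMap_eq, C_mul_monomial, mul_one]

/-- Evaluation at monomials is the map of monoid algebras induced by the map of exponents, so one is
injective exactly when the other is. -/
theorem algebraicIndependent_monomial_iff {ι σ k : Type*} [Field k] (d : ι → σ →₀ ℕ) :
    AlgebraicIndependent k (fun i => monomial (d i) (1 : k)) ↔ LinearIndependent ℕ d := by
  refine ⟨fun h s t hst => ?_, fun h => ?_⟩
  · have : monomial s (1 : k) = monomial t 1 := by
      apply h
      rw [aeval_monomial_one_monomial, aeval_monomial_one_monomial, hst]
    exact (monomial_left_injective (one_ne_zero)) this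
  · have : (aeval (fun i => monomial (d i) (1 : k)) : MvPolynomial ι k →ₐ[k] _) =
        AddMonoidAlgebra.mapDomainAlgHom k k
          (Finsupp.linearCombination ℕ d).toAddMonoidHom := by
      apply algHom_ext
      intro i
      rw [aeval_X, X]
      change _ = AddMonoidAlgebra.mapDomain _ (AddMonoidAlgebra.single _ _)
      rw [AddMonoidAlgebra.mapDomain_single]
      simp [single_eq_monomial]
    rw [AlgebraicIndependent, this]
    exact AddMonoidAlgebra.mapDomain_injective h

/-- A transcendence basis can be chosen among the generating monomials, and a basis of the span
among the exponent vectors; each choice bounds one side by the other. -/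
theorem toNat_trdeg_range_aeval_monomial {ι σ k : Type*} [Finite ι] [Finite σ] [Field k]
    (d : ι → σ →₀ ℕ) :
    (Algebra.trdeg k (aeval (R := k) (fun i => monomial (d i) (1 : k))).range).toNat =
      Module.finrank ℚ (Submodule.span ℚ (Set.range fun i => exponentVec (d i))) := by
  set ψ := aeval (R := k) (fun i => monomial (d i) (1 : k)) with hψ
  let y : ι → ψ.range := fun i => ⟨monomial (d i) 1, X i, by simp [hψ]⟩
  have hadj : Algebra.adjoin k (Set.range y) = ⊤ := by
    apply Subalgebra.map_injective (f := ψ.range.val) Subtype.val_injective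
    rw [AlgHom.map_adjoin, Algebra.map_top, Subalgebra.range_val, ← Set.range_comp]
    exact Algebra.adjoin_range_eq_range_aeval k _
  have : Algebra.IsAlgebraic (Algebra.adjoin k (Set.range y)) ψ.range := by
    refine ⟨fun x => ?_⟩
    have hx : x ∈ Algebra.adjoin k (Set.range y) := hadj ▸ Algebra.mem_top
    exact isAlgebraic_algebraMap (⟨x, hx⟩ : Algebra.adjoin k (Set.range y))
  obtain ⟨T, hT, hTb⟩ := exists_isTranscendenceBasis_subset (R := k) (Set.range y)
  choose i hi using fun t : T => hT t.2
  have hTf : Finite T := (Set.finite_range y).subset hT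
  have htd : (Algebra.trdeg k ψ.range).toNat = Nat.card T := by
    rw [← hTb.cardinalMk_eq_trdeg]; rfl
  have hyi : y ∘ i = ((↑) : T → ψ.range) := _root_.funext hi
  apply le_antisymm
  · have h1 : LinearIndependent ℚ (fun t : T => exponentVec (d (i t))) := by
      rw [linearIndependent_exponentVec_iff (fun t => d (i t))]
      rw [← algebraicIndependent_monomial_iff (k := k)]
      exact (hyi ▸ hTb.1 : AlgebraicIndependent k (y ∘ i)).map' (f := ψ.range.val)
        Subtype.val_injective
    have := Fintype.ofFinite T
    rw [htd, Nat.card_eq_fintype_card, ← finrank_span_eq_card h1]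
    have := Fintype.ofFinite σ
    apply Submodule.finrank_mono
    apply Submodule.span_mono
    rintro _ ⟨t, rfl⟩
    exact ⟨i t, rfl⟩
  · obtain ⟨κ, a, ha, hsp, hli⟩ := exists_linearIndependent' ℚ (fun i => exponentVec (d i))
    have : Finite κ := Finite.of_injective a ha
    have := Fintype.ofFinite κ
    rw [← hsp, finrank_span_eq_card hli, ← Nat.card_eq_fintype_card]
    have h1 : AlgebraicIndependent k (y ∘ a) :=
      (AlgHom.algebraicIndependent_iff ψ.range.val Subtype.val_injective).1
        ((algebraicIndependent_monomial_iff (k := k) (fun j => d (a j))).2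
          ((linearIndependent_exponentVec_iff _).1 hli))
    have h2 := h1.lift_cardinalMk_le_trdeg
    rw [← hTb.cardinalMk_eq_trdeg] at h2
    rw [htd]
    have h3 := Cardinal.toNat_le_toNat h2 (by simp)
    simpa [Nat.card] using h3

end MvPolynomial

/-! ### Homogeneous components and the local ring at the origin -/

namespace MvPolynomial

theorem degree_linearCombination {ι σ : Type*} (d : ι → σ →₀ ℕ) {m : ℕ}
    (hd : ∀ i, (d i).degree = m) (s : ι →₀ ℕ) :
    (Finsupp.linearCombination ℕ d s).degree = m * s.degree := by
  induction s using Finsupp.induction_linear with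
  | zero => simp
  | add s t hs ht => simp [hs, ht, mul_add]
  | single i n => simp [hd, mul_comm]

theorem homogeneousComponent_monomial {σ k : Type*} [CommSemiring k] (n : ℕ) (s : σ →₀ ℕ) (c : k) :
    homogeneousComponent n (monomial s c) = if s.degree = n then monomial s c else 0 := by
  have h : monomial s c ∈ homogeneousSubmodule σ k s.degree := isHomogeneous_monomial c rfl
  rw [homogeneousComponent_of_mem h]
  simp only [eq_comm]

theorem homogeneousComponent_aeval_monomial {ι σ k : Type*} [Field k] (d : ι → σ →₀ ℕ) {m : ℕ}
    (hm : 0 < m) (hd : ∀ i, (d i).degree = m) (n : ℕ) (f : MvPolynomial ι k) :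
    homogeneousComponent (m * n) (aeval (fun i => monomial (d i) (1 : k)) f) =
      aeval (fun i => monomial (d i) (1 : k)) (homogeneousComponent n f) := by
  induction f using MvPolynomial.induction_on' with
  | monomial s c =>
    rw [aeval_monomial_one_monomial, homogeneousComponent_monomial, homogeneousComponent_monomial,
      degree_linearCombination d hd]
    simp only [Nat.mul_right_inj hm.ne']
    split_ifs
    · rw [aeval_monomial_one_monomial]
    · simp
  | add p q hp hq => simp only [map_add, hp, hq]

theorem isMaximal_idealOfVars (σ k : Type*) [Field k] : (idealOfVars σ k).IsMaximal := by
  have h : idealOfVars σ k = RingHom.ker (constantCoeff : MvPolynomial σ k →+* k) := by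
    ext f
    rw [← pow_one (idealOfVars σ k), mem_pow_idealOfVars_iff', RingHom.mem_ker,
      constantCoeff_eq]
    simp [Finsupp.degree_eq_zero_iff]
  rw [h]
  exact RingHom.ker_isMaximal_of_surjective _ fun a => ⟨C a, by simp⟩

theorem eq_zero_of_isHomogeneous_of_algebraMap_mem {σ k : Type*} [Field k]
    {p : MvPolynomial σ k} {n N : ℕ} (hp : p.IsHomogeneous n) (hN : n < N)
    (h : algebraMap _ (Localization.AtPrime (idealOfVars σ k)) p ∈
      IsLocalRing.maximalIdeal (Localization.AtPrime (idealOfVars σ k)) ^ N) : p = 0 := by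
  have := isMaximal_idealOfVars σ k
  have h1 : p ∈ idealOfVars σ k ^ N := by
    rw [← IsLocalization.AtPrime.under_maximalIdeal_pow
      (idealOfVars σ k) (Localization.AtPrime (idealOfVars σ k))]
    exact h
  rw [mem_pow_idealOfVars_iff'] at h1
  ext x
  by_contra hx
  have h2 := hp hx
  rw [coeff_zero] at hx
  refine hx (h1 x ?_)
  rw [Finsupp.degree_eq_weight_one]
  exact h2 ▸ hN

end MvPolynomial

/-! ### Rees algebra and special fiber ring -/

namespace Ideal

/-- The quotient map from the Rees algebra to the associated graded ring. -/
def toAssocGradedRing {R : Type*} [CommRing R] (I : Ideal R) :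
    reesAlgebra I →+* I.AssocGradedRing :=
  Ideal.Quotient.mk (I.map (algebraMap R (reesAlgebra I)))

theorem toAssocGradedRing_surjective {R : Type*} [CommRing R] (I : Ideal R) :
    Function.Surjective I.toAssocGradedRing :=
  Ideal.Quotient.mk_surjective

theorem ker_toAssocGradedRing {R : Type*} [CommRing R] (I : Ideal R) :
    RingHom.ker I.toAssocGradedRing = I.map (algebraMap R (reesAlgebra I)) :=
  Ideal.mk_ker

/-- The quotient map from the Rees algebra to the special fiber ring. -/
def toSpecialFiberRing {R : Type*} [CommRing R] [IsLocalRing R] (I : Ideal R) :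
    reesAlgebra I →+* I.SpecialFiberRing :=
  RingHom.comp (Ideal.Quotient.mk
    ((IsLocalRing.maximalIdeal R).map (algebraMap R I.AssocGradedRing))) I.toAssocGradedRing

theorem toSpecialFiberRing_surjective {R : Type*} [CommRing R] [IsLocalRing R] (I : Ideal R) :
    Function.Surjective I.toSpecialFiberRing :=
  Ideal.Quotient.mk_surjective.comp I.toAssocGradedRing_surjective

/-- Since `I ≤ 𝔪`, first dividing by `I` costs nothing: the special fiber ring is `ℛ / 𝔪ℛ`. -/
theorem ker_toSpecialFiberRing {R : Type*} [CommRing R] [IsLocalRing R] {I : Ideal R}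
    (hI : I ≤ IsLocalRing.maximalIdeal R) :
    RingHom.ker I.toSpecialFiberRing =
      (IsLocalRing.maximalIdeal R).map (algebraMap R (reesAlgebra I)) := by
  have h : (IsLocalRing.maximalIdeal R).map (algebraMap R I.AssocGradedRing) =
      ((IsLocalRing.maximalIdeal R).map (algebraMap R (reesAlgebra I))).map
        I.toAssocGradedRing :=
    (Ideal.map_map _ _).symm
  have h1 : RingHom.ker I.toSpecialFiberRing =
      ((IsLocalRing.maximalIdeal R).map (algebraMap R I.AssocGradedRing)).comap
        I.toAssocGradedRing := by
    ext z
    exact Ideal.Quotient.eq_zero_iff_mem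
  rw [h1, h, Ideal.comap_map_of_surjective _ I.toAssocGradedRing_surjective,
    ← RingHom.ker_eq_comap_bot, ker_toAssocGradedRing, sup_eq_left]
  exact Ideal.map_mono hI

theorem coeff_mem_of_mem_map_reesAlgebra {R : Type*} [CommRing R] {I J : Ideal R}
    {z : reesAlgebra I} (hz : z ∈ J.map (algebraMap R (reesAlgebra I))) (n : ℕ) :
    (z : Polynomial R).coeff n ∈ J * I ^ n := by
  induction hz using Submodule.span_induction generalizing n with
  | mem x hx =>
    obtain ⟨r, hr, rfl⟩ := hx
    change (Polynomial.C r).coeff n ∈ _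
    rw [Polynomial.coeff_C]
    split_ifs with h
    · simpa [h] using hr
    · exact zero_mem _
  | zero => simp
  | add x y _ _ hx hy =>
    rw [Subalgebra.coe_add, Polynomial.coeff_add]
    exact add_mem (hx n) (hy n)
  | smul a x _ hx =>
    rw [smul_eq_mul, Subalgebra.coe_mul, Polynomial.coeff_mul]
    refine Ideal.sum_mem _ fun ij hij => ?_
    rw [← Finset.HasAntidiagonal.mem_antidiagonal.1 hij, pow_add, mul_left_comm]
    exact Ideal.mul_mem_mul (a.2 ij.1) (hx ij.2)

end Ideal

/-! ### Special fiber ring of a monomial ideal generated in one degree -/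

namespace MvPolynomial

section

variable {ι σ k : Type*} [Field k] (d : ι → σ →₀ ℕ)

/-- The ideal generated by monomials in the local ring at the origin. -/
def localMonomialIdeal (k : Type*) [Field k] (d : ι → σ →₀ ℕ) :
    Ideal (Localization.AtPrime (idealOfVars σ k)) :=
  Ideal.span (Set.range fun i => algebraMap _ _ (monomial (d i) (1 : k)))

/-- The presentation of the monomial subalgebra `k[M_i t]` of the Rees algebra. -/
def toReesAlgebra (k : Type*) [Field k] (d : ι → σ →₀ ℕ) :
    MvPolynomial ι k →+* reesAlgebra (localMonomialIdeal k d) :=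
  eval₂Hom ((algebraMap (Localization.AtPrime (idealOfVars σ k)) _).comp ((algebraMap _ _).comp
      (C : k →+* MvPolynomial σ k)))
    fun i => ⟨Polynomial.monomial 1 (algebraMap _ _ (monomial (d i) (1 : k))),
      reesAlgebra.monomial_mem.2 (by
        rw [pow_one]; exact Ideal.subset_span ⟨i, rfl⟩)⟩

theorem coe_toReesAlgebra_monomial (s : ι →₀ ℕ) (c : k) :
    (toReesAlgebra k d (monomial s c) : Polynomial (Localization.AtPrime (idealOfVars σ k))) =
      Polynomial.monomial s.degree
        (algebraMap _ _ (aeval (fun i => monomial (d i) (1 : k)) (monomial s c))) := by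
  rw [toReesAlgebra, coe_eval₂Hom, eval₂_monomial, aeval_monomial]
  rw [Subalgebra.coe_mul, Finsupp.prod, Finsupp.prod, SubmonoidClass.coe_finsetProd]
  simp only [SubmonoidClass.coe_pow, Polynomial.monomial_pow, one_mul]
  have : ∀ t : Finset ι, ∏ i ∈ t, Polynomial.monomial (s i)
      ((algebraMap (MvPolynomial σ k) (Localization.AtPrime (idealOfVars σ k))
        (monomial (d i) (1 : k))) ^ s i) = Polynomial.monomial (∑ i ∈ t, s i)
      (algebraMap (MvPolynomial σ k) (Localization.AtPrime (idealOfVars σ k))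
        (∏ i ∈ t, (monomial (d i) (1 : k)) ^ s i)) := by
    classical
    intro t
    induction t using Finset.induction_on with
    | empty => simp
    | insert i t hi ih =>
      rw [Finset.prod_insert hi, Finset.prod_insert hi, Finset.sum_insert hi, ih,
        Polynomial.monomial_mul_monomial, map_mul (algebraMap _ _), map_pow (algebraMap _ _)]
  rw [this, map_mul]
  exact Polynomial.C_mul_monomial

theorem coeff_toReesAlgebra (f : MvPolynomial ι k) (n : ℕ) :
    (toReesAlgebra k d f : Polynomial (Localization.AtPrime (idealOfVars σ k))).coeff n =
      algebraMap _ _ (aeval (fun i => monomial (d i) (1 : k)) (homogeneousComponent n f)) := by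
  induction f using MvPolynomial.induction_on' with
  | monomial s c =>
    rw [coe_toReesAlgebra_monomial, Polynomial.coeff_monomial, homogeneousComponent_monomial]
    split_ifs <;> simp
  | add p q hp hq => rw [map_add, Subalgebra.coe_add, Polynomial.coeff_add, hp, hq]; simp

variable {m : ℕ}

theorem localMonomialIdeal_le (hd : ∀ i, (d i).degree = m) :
    localMonomialIdeal k d ≤ IsLocalRing.maximalIdeal (Localization.AtPrime (idealOfVars σ k)) ^ m := by
  rw [localMonomialIdeal, Ideal.span_le]
  rintro _ ⟨i, rfl⟩
  rw [← Localization.AtPrime.map_eq_maximalIdeal, ← Ideal.map_pow]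
  apply Ideal.mem_map_of_mem
  rw [monomial_mem_pow_idealOfVars_iff _ _ one_ne_zero, hd]

theorem ker_toSpecialFiberRing_comp_toReesAlgebra (hm : 0 < m)
    (hd : ∀ i, (d i).degree = m) :
    RingHom.ker ((localMonomialIdeal k d).toSpecialFiberRing.comp (toReesAlgebra k d)) =
      RingHom.ker (aeval (R := k) fun i => monomial (d i) (1 : k)) := by
  have hle := localMonomialIdeal_le (k := k) d hd
  rw [← RingHom.comap_ker, Ideal.ker_toSpecialFiberRing (hle.trans (Ideal.pow_le_self hm.ne'))]
  ext f
  rw [Ideal.mem_comap, RingHom.mem_ker]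
  constructor
  · intro hf
    rw [← sum_homogeneousComponent f, map_sum]
    refine Finset.sum_eq_zero fun n _ => ?_
    -- The coefficient of `tⁿ` is a form of degree `m * n`, yet lies in `𝔪 Iⁿ ≤ 𝔪 ^ (m * n + 1)`; so
    -- it vanishes.
    refine eq_zero_of_isHomogeneous_of_algebraMap_mem (n := m * n) (N := m * n + 1) ?_
      (Nat.lt_succ_self _) ?_
    · rw [← homogeneousComponent_aeval_monomial d hm hd]
      exact homogeneousComponent_isHomogeneous _ _
    · rw [← coeff_toReesAlgebra, pow_succ', pow_mul]
      exact Ideal.mul_mono_right (Ideal.pow_right_mono hle n)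
        (Ideal.coeff_mem_of_mem_map_reesAlgebra hf n)
  · intro hf
    have : toReesAlgebra k d f = 0 := by
      ext n
      rw [coeff_toReesAlgebra, ← homogeneousComponent_aeval_monomial d hm hd, hf]
      simp
    rw [this]
    exact zero_mem _

theorem toSpecialFiberRing_comp_toReesAlgebra_surjective (hm : 0 < m)
    (hd : ∀ i, (d i).degree = m) :
    Function.Surjective ((localMonomialIdeal k d).toSpecialFiberRing.comp (toReesAlgebra k d)) := by
  set I := localMonomialIdeal k d with hI
  set q := I.toSpecialFiberRing with hq
  set R := Localization.AtPrime (idealOfVars σ k)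
  have hle : I ≤ IsLocalRing.maximalIdeal R :=
    (localMonomialIdeal_le (k := k) d hd).trans (Ideal.pow_le_self hm.ne')
  -- The residue field is `k`: modulo `𝔪`, `r` agrees with a polynomial, hence with its constant
  -- term.
  have hR (r : R) : q (algebraMap R _ r) ∈ (q.comp (toReesAlgebra k d)).range := by
    have := isMaximal_idealOfVars σ k
    obtain ⟨p, hp⟩ : ∃ p : MvPolynomial σ k,
        r - algebraMap (MvPolynomial σ k) R p ∈ IsLocalRing.maximalIdeal R := by
      obtain ⟨p, hp⟩ := (IsLocalization.AtPrime.equivQuotMaximalIdeal (idealOfVars σ k) R).surjective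
        (Ideal.Quotient.mk _ r)
      obtain ⟨p, rfl⟩ := Ideal.Quotient.mk_surjective p
      refine ⟨p, ?_⟩
      rw [← Ideal.Quotient.eq, ← hp]
      rfl
    have hp' : p - C (constantCoeff p) ∈ idealOfVars σ k := by
      rw [← pow_one (idealOfVars σ k), mem_pow_idealOfVars_iff']
      intro x hx
      obtain rfl := (Finsupp.degree_eq_zero_iff x).1 (by omega)
      simp [constantCoeff_eq]
    have hr : r - algebraMap (MvPolynomial σ k) R (C (constantCoeff p)) ∈ IsLocalRing.maximalIdeal R := by
      have h1 : algebraMap (MvPolynomial σ k) R (p - C (constantCoeff p)) ∈ IsLocalRing.maximalIdeal R := by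
        rw [← Localization.AtPrime.map_eq_maximalIdeal]
        exact Ideal.mem_map_of_mem _ hp'
      have := add_mem hp h1
      rwa [map_sub, sub_add_sub_cancel] at this
    refine ⟨C (constantCoeff p), ?_⟩
    have h0 : algebraMap R (reesAlgebra I) (r - algebraMap (MvPolynomial σ k) R (C (constantCoeff p))) ∈
        RingHom.ker q := by
      rw [Ideal.ker_toSpecialFiberRing hle]
      exact Ideal.mem_map_of_mem _ hr
    rw [RingHom.mem_ker, map_sub, map_sub, sub_eq_zero] at h0
    rw [h0]
    refine (congrArg q ?_ : q (toReesAlgebra k d (C (constantCoeff p))) = _)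
    simp [toReesAlgebra]
    rfl
  -- By `hR` the preimage of the image is an `R`-subalgebra, so only the degree-one generators of
  -- the Rees algebra need checking.
  let S : Subalgebra R (reesAlgebra I) :=
    { ((q.comp (toReesAlgebra k d)).range.comap q) with
      algebraMap_mem' := hR }
  have hS : (reesAlgebra I) ≤ S.map (reesAlgebra I).val := by
    conv_lhs => rw [← adjoin_monomial_eq_reesAlgebra]
    rw [Algebra.adjoin_le_iff]
    change ((Submodule.map (Polynomial.monomial 1) I : Submodule R _) : Set (Polynomial R)) ⊆
      ((Subalgebra.toSubmodule (S.map (reesAlgebra I).val) : Submodule R _) : Set (Polynomial R))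
    rw [SetLike.coe_subset_coe, Submodule.map_le_iff_le_comap]
    refine Ideal.span_le.2 ?_
    rintro _ ⟨i, rfl⟩
    refine ⟨toReesAlgebra k d (X i), ⟨X i, rfl⟩, ?_⟩
    simp [toReesAlgebra]
  intro z
  obtain ⟨w, rfl⟩ := I.toSpecialFiberRing_surjective z
  obtain ⟨w', hw', h⟩ := hS w.2
  obtain rfl : w' = w := Subtype.ext h
  exact hw'

theorem analyticSpread_localMonomialIdeal [Finite ι] [Finite σ] (hm : 0 < m)
    (hd : ∀ i, (d i).degree = m) :
    (localMonomialIdeal k d).analyticSpread =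
      (Module.finrank ℚ (Submodule.span ℚ (Set.range fun i => exponentVec (d i))) :
        WithBot ℕ∞) := by
  set ψ := aeval (R := k) (fun i => monomial (d i) (1 : k)) with hψ
  have e := (RingHom.quotientKerEquivOfSurjective
    (toSpecialFiberRing_comp_toReesAlgebra_surjective (k := k) d hm hd)).symm.trans
    ((Ideal.quotEquivOfEq (ker_toSpecialFiberRing_comp_toReesAlgebra (k := k) d hm hd)).trans
      (Ideal.quotientKerEquivRange ψ).toRingEquiv)
  have : Algebra.FiniteType k ψ.range :=
    Algebra.FiniteType.of_surjective ψ.rangeRestrict ψ.rangeRestrict_surjective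
  rw [Ideal.analyticSpread, ringKrullDim_eq_of_ringEquiv e,
    ringKrullDim_eq_toNat_trdeg k ψ.range, hψ, toNat_trdeg_range_aeval_monomial]

end

end MvPolynomial

/-! ### Rank of the incidence vectors -/

namespace Hypergraph

open MvPolynomial

variable {α : Type*} {G : Hypergraph α}

theorem mk_eq_of_mem_edge {e : Set α} (he : e ∈ G.edgeSet) {x y : G.vertexSet}
    (hx : (x : α) ∈ e) (hy : (y : α) ∈ e) :
    Quotient.mk G.connectedSetoid x = Quotient.mk G.connectedSetoid y :=
  Quotient.sound (Relation.EqvGen.rel _ _ ⟨e, he, hx, hy⟩)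

theorem mem_component_edgeSet {e : Set α} (he : e ∈ G.edgeSet) {x : G.vertexSet}
    (hx : (x : α) ∈ e) : e ∈ (G.component (Quotient.mk G.connectedSetoid x)).edgeSet :=
  ⟨he, fun y hy => ⟨⟨y, G.subset_vertexSet_of_mem_edgeSet he hy⟩, rfl,
    mk_eq_of_mem_edge he hy hx⟩⟩

theorem connectedSetoid_of_pivotSetoid {m : ℕ} (hm : 2 ≤ m) (hunif : G.IsUniform m)
    {x y : G.vertexSet} (h : G.pivotSetoid x y) : G.connectedSetoid x y := by
  induction h with
  | rel x y h =>
    obtain ⟨A, hA, hx, hy⟩ := h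
    -- As `m ≥ 2`, the two edges share a node `z`, which links `x` to `y`.
    obtain ⟨z, hz⟩ : A.Nonempty := by
      by_contra h
      rw [Set.not_nonempty_iff_eq_empty] at h
      have := (hunif _ hx).2
      simp only [h, Set.union_empty, Set.ncard_singleton] at this
      omega
    exact .trans _ ⟨z, (hA hz).1⟩ _
      (.rel _ _ ⟨_, hx, .inl rfl, .inr hz⟩) (.rel _ _ ⟨_, hy, .inr hz, .inl rfl⟩)
  | refl x => exact .refl _
  | symm x y _ h => exact .symm _ _ h
  | trans x y z _ _ h1 h2 => exact .trans _ _ _ h1 h2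

variable (G)

/-- The exponent vector of the square-free monomial of a set of nodes. -/
def edgeExponent [Finite G.vertexSet] (e : Set α) : G.vertexSet →₀ ℕ :=
  Finsupp.equivFunOnFinite.symm (Set.indicator {x | (x : α) ∈ e} 1)

theorem edgeExponent_apply [Finite G.vertexSet] (e : Set α) (x : G.vertexSet) [Decidable (x.1 ∈ e)] :
    G.edgeExponent e x = if (x : α) ∈ e then 1 else 0 := by
  classical
  simp [edgeExponent, Set.indicator_apply]

theorem edgeMonomial_eq_monomial [Finite G.vertexSet] (k : Type*) [Field k] (e : Set α) :
    G.edgeMonomial k e = monomial (G.edgeExponent e) 1 := by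
  classical
  have := Fintype.ofFinite G.vertexSet
  rw [edgeMonomial, finprod_eq_prod_of_fintype, monomial_eq, map_one, one_mul,
    Finsupp.prod_fintype _ _ (fun _ => pow_zero _)]
  refine Finset.prod_congr rfl fun x _ => ?_
  rw [edgeExponent_apply, finprod_eq_if]
  split_ifs <;> simp

theorem degree_edgeExponent [Finite G.vertexSet] {e : Set α} (he : e ⊆ G.vertexSet) :
    (G.edgeExponent e).degree = e.ncard := by
  classical
  have := Fintype.ofFinite G.vertexSet
  rw [Finsupp.degree_eq_sum]
  simp only [edgeExponent_apply, Finset.sum_boole, Nat.cast_id]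
  rw [← Set.ncard_coe_finset, ← Set.ncard_image_of_injective _ Subtype.val_injective]
  congr 1
  ext x
  simpa using fun hx => he hx

theorem edgeIdeal_eq_localMonomialIdeal [Finite G.vertexSet] (k : Type*) [Field k] :
    G.edgeIdeal k = localMonomialIdeal k fun e : G.edgeSet => G.edgeExponent e := by
  rw [edgeIdeal, localMonomialIdeal, Set.image_eq_range]
  simp only [edgeMonomial_eq_monomial]

section

variable [Finite G.vertexSet]

/-- The incidence vector of a set of nodes. -/
def incidence (e : Set α) : G.vertexSet →₀ ℚ := exponentVec (G.edgeExponent e)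

theorem incidence_apply (e : Set α) (x : G.vertexSet) [Decidable (x.1 ∈ e)] :
    G.incidence e x = if (x : α) ∈ e then 1 else 0 := by
  rw [incidence, exponentVec_apply, edgeExponent_apply]
  split_ifs <;> simp

/-- The span of the incidence vectors of the edges. -/
def edgeSpan : Submodule ℚ (G.vertexSet →₀ ℚ) :=
  Submodule.span ℚ (Set.range fun e : G.edgeSet => G.incidence e)

theorem incidence_mem_edgeSpan {e : Set α} (he : e ∈ G.edgeSet) : G.incidence e ∈ G.edgeSpan :=
  Submodule.subset_span ⟨⟨e, he⟩, rfl⟩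

theorem incidence_insert {x : G.vertexSet} {A : Set α} (hx : (x : α) ∉ A) :
    G.incidence ({(x : α)} ∪ A) = Finsupp.single x 1 + G.incidence A := by
  classical
  ext y
  rw [Finsupp.add_apply, incidence_apply, incidence_apply, Finsupp.single_apply]
  by_cases h : x = y
  · subst h; simp [hx]
  · have : (y : α) ≠ x := fun h' => h (Subtype.ext h'.symm)
    simp [h, this]

variable {G}

theorem single_sub_single_mem_edgeSpan {x y : G.vertexSet} (h : G.pivotSetoid x y) :
    Finsupp.single x (1 : ℚ) - Finsupp.single y 1 ∈ G.edgeSpan := by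
  induction h with
  | rel x y h =>
    obtain ⟨A, hA, hx, hy⟩ := h
    have h1 := sub_mem (G.incidence_mem_edgeSpan hx) (G.incidence_mem_edgeSpan hy)
    rwa [incidence_insert _ (fun h => (hA h).2 (by simp)),
      incidence_insert _ (fun h => (hA h).2 (by simp)), add_sub_add_right_eq_sub] at h1
  | refl x => simp
  | symm x y _ h => rw [← neg_sub]; exact neg_mem h
  | trans x y z _ _ h1 h2 => rw [← sub_add_sub_cancel]; exact add_mem h1 h2

variable (G) in
/-- The sum of a vector over each of the pivot classes. -/
def pivotSum : (G.vertexSet →₀ ℚ) →ₗ[ℚ] (G.PivotClass →₀ ℚ) :=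
  Finsupp.lmapDomain ℚ ℚ (Quotient.mk G.pivotSetoid)

/-- Modulo the edge span, the mass of each class can be moved to a chosen representative; nothing is
left when all class sums vanish. -/
theorem ker_pivotSum_le : LinearMap.ker G.pivotSum ≤ G.edgeSpan := by
  have key (f : G.vertexSet →₀ ℚ) :
      f - Finsupp.lmapDomain ℚ ℚ (Quotient.out : G.PivotClass → G.vertexSet) (G.pivotSum f) ∈
        G.edgeSpan := by
    induction f using Finsupp.induction_linear with
    | zero => simp
    | add f g hf hg => rw [map_add, map_add, add_sub_add_comm]; exact add_mem hf hg
    | single x a =>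
      have h := Submodule.smul_mem _ a (single_sub_single_mem_edgeSpan
        (G.pivotSetoid.symm (Quotient.mk_out (s := G.pivotSetoid) x)))
      simpa [pivotSum, smul_sub] using h
  intro f hf
  have h := key f
  rwa [LinearMap.mem_ker.1 hf, map_zero, sub_zero] at h

theorem finrank_ker_pivotSum_add :
    Module.finrank ℚ (LinearMap.ker G.pivotSum) + Nat.card G.PivotClass =
      Nat.card G.vertexSet := by
  have := Fintype.ofFinite G.vertexSet
  have := Fintype.ofFinite G.PivotClass
  have hs : LinearMap.range G.pivotSum = ⊤ :=
    LinearMap.range_eq_top.2 (Finsupp.mapDomain_surjective Quotient.mk_surjective)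
  have h := G.pivotSum.finrank_range_add_finrank_ker
  rw [hs, finrank_top, Module.finrank_finsupp_self, Module.finrank_finsupp_self] at h
  rw [Nat.card_eq_fintype_card, Nat.card_eq_fintype_card]
  omega

theorem finrank_edgeSpan_eq :
    Module.finrank ℚ G.edgeSpan = Module.finrank ℚ (LinearMap.ker G.pivotSum) +
      Module.finrank ℚ (G.edgeSpan.map G.pivotSum) := by
  have h := (G.pivotSum.domRestrict G.edgeSpan).finrank_range_add_finrank_ker
  rw [LinearMap.range_domRestrict, LinearMap.ker_domRestrict] at h
  rw [← h, add_comm]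
  congr 1
  exact (Submodule.comapSubtypeEquivOfLe ker_pivotSum_le).finrank_eq

/-- Each edge is `e ∩ f` plus one node, and the two extra nodes are pivot equivalent via `A = e ∩
f`. -/
theorem pivotSum_incidence_eq {m : ℕ} (hunif : G.IsUniform m) {e f : Set α} (he : e ∈ G.edgeSet)
    (hf : f ∈ G.edgeSet) (h : (e ∩ f).ncard + 1 = m) :
    G.pivotSum (G.incidence e) = G.pivotSum (G.incidence f) := by
  have aux {e f : Set α} (he : e ∈ G.edgeSet) (h : (e ∩ f).ncard + 1 = m) :
      ∃ x : G.vertexSet, (x : α) ∉ e ∩ f ∧ {(x : α)} ∪ (e ∩ f) = e := by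
    obtain ⟨hfin, hcard⟩ := hunif e he
    have h1 : (e \ f).ncard = 1 := by
      have := Set.ncard_inter_add_ncard_sdiff_eq_ncard e f hfin
      omega
    obtain ⟨x, hx⟩ := Set.ncard_eq_one.1 h1
    have hxe : x ∈ e \ f := hx ▸ rfl
    refine ⟨⟨x, G.subset_vertexSet_of_mem_edgeSet he hxe.1⟩, fun h => hxe.2 h.2, ?_⟩
    change {x} ∪ (e ∩ f) = e
    rw [← hx, Set.sdiff_union_inter]
  obtain ⟨x, hx, hxe⟩ := aux he h
  obtain ⟨y, hy, hyf⟩ := aux hf (by rwa [Set.inter_comm])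
  rw [Set.inter_comm] at hy hyf
  have hxy : G.PivotStep x y := by
    refine ⟨e ∩ f, fun z hz => ⟨G.subset_vertexSet_of_mem_edgeSet he hz.1, ?_⟩,
      hxe.symm ▸ he, hyf.symm ▸ hf⟩
    rintro (rfl | rfl)
    · exact hx hz
    · exact hy hz
  have hq : Quotient.mk G.pivotSetoid x = Quotient.mk G.pivotSetoid y :=
    Quotient.sound (Relation.EqvGen.rel _ _ hxy)
  rw [← hxe, incidence_insert _ hx]
  conv_rhs => rw [← hyf, incidence_insert _ hy]
  rw [map_add, map_add]
  congr 1
  simp [pivotSum, hq]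

theorem pivotSum_incidence_eq_of_isProperlyConnected {m : ℕ} (hunif : G.IsUniform m)
    {C : G.ConnectedComponent} (hC : (G.component C).IsProperlyConnected m) {e f : Set α}
    (he : e ∈ (G.component C).edgeSet) (hf : f ∈ (G.component C).edgeSet) :
    G.pivotSum (G.incidence e) = G.pivotSum (G.incidence f) := by
  induction hC e he f hf with
  | refl => rfl
  | tail _ h ih => exact (ih h.1).trans (pivotSum_incidence_eq hunif h.1.1 h.2.1.1 h.2.2)

theorem lmapDomain_incidence {m : ℕ} (hunif : G.IsUniform m) {e : Set α} (he : e ∈ G.edgeSet)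
    {x : G.vertexSet} (hx : (x : α) ∈ e) :
    Finsupp.lmapDomain ℚ ℚ (Quotient.mk G.connectedSetoid) (G.incidence e) =
      Finsupp.single (Quotient.mk G.connectedSetoid x) (m : ℚ) := by
  classical
  have := Fintype.ofFinite G.vertexSet
  rw [← (hunif e he).2, ← G.degree_edgeExponent (G.subset_vertexSet_of_mem_edgeSet he),
    Finsupp.degree_eq_sum, Finsupp.lmapDomain_apply, Finsupp.mapDomain,
    Finsupp.sum_fintype _ _ (by simp), Nat.cast_sum, Finsupp.single_finsetSum]
  refine Finset.sum_congr rfl fun y _ => ?_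
  rw [incidence, exponentVec_apply]
  by_cases hy : (y : α) ∈ e
  · rw [mk_eq_of_mem_edge he hx hy]
  · simp [edgeExponent_apply, hy]

theorem finrank_map_pivotSum_edgeSpan {m : ℕ} (hm : 2 ≤ m) (hunif : G.IsUniform m)
    (hiso : ∀ x ∈ G.vertexSet, ¬ G.IsIsolated x)
    (hconn : ∀ C : G.ConnectedComponent, (G.component C).IsProperlyConnected m) :
    Module.finrank ℚ (G.edgeSpan.map G.pivotSum) = Nat.card G.ConnectedComponent := by
  have hex (C : G.ConnectedComponent) : ∃ e ∈ G.edgeSet, ((Quotient.out C : G.vertexSet) : α) ∈ e := by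
    simpa [IsIsolated] using hiso _ (Quotient.out C : G.vertexSet).2
  choose E hE hEmem using hex
  -- Pivot classes refine components; pushing forward along `κ` sends the class vector of an edge in
  -- `C` to `m` times the basis vector of `C`, which separates the components.
  let κ : G.PivotClass → G.ConnectedComponent :=
    Quotient.map' id fun _ _ h => connectedSetoid_of_pivotSetoid hm hunif h
  have hκ : Finsupp.lmapDomain ℚ ℚ κ ∘ₗ G.pivotSum =
      Finsupp.lmapDomain ℚ ℚ (Quotient.mk G.connectedSetoid) :=
    (Finsupp.lmapDomain_comp ℚ ℚ _ _).symm
  let w (C : G.ConnectedComponent) := G.pivotSum (G.incidence (E C))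
  have hw (C) : Finsupp.lmapDomain ℚ ℚ κ (w C) = Finsupp.single C (m : ℚ) := by
    change (Finsupp.lmapDomain ℚ ℚ κ ∘ₗ G.pivotSum) _ = _
    rw [hκ, lmapDomain_incidence hunif (hE C) (hEmem C), Quotient.out_eq]
  have hm0 : (m : ℚ) ≠ 0 := by positivity
  have hli : LinearIndependent ℚ w := by
    apply LinearIndependent.of_comp (Finsupp.lmapDomain ℚ ℚ κ)
    rw [show (Finsupp.lmapDomain ℚ ℚ κ) ∘ w = fun C => Finsupp.single C (m : ℚ) from funext hw]
    exact Finsupp.linearIndependent_single_of_ne_zero fun _ => hm0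
  have hspan : G.edgeSpan.map G.pivotSum = Submodule.span ℚ (Set.range w) := by
    rw [edgeSpan, Submodule.map_span, ← Set.range_comp]
    congr 1
    ext z
    constructor
    · rintro ⟨e, rfl⟩
      obtain ⟨x, hx⟩ : (e : Set α).Nonempty := by
        apply Set.nonempty_of_ncard_ne_zero
        rw [(hunif e e.2).2]
        omega
      let x' : G.vertexSet := ⟨x, G.subset_vertexSet_of_mem_edgeSet e.2 hx⟩
      refine ⟨Quotient.mk _ x', pivotSum_incidence_eq_of_isProperlyConnected hunif
        (hconn (Quotient.mk _ x')) ?_ (mem_component_edgeSet e.2 (x := x') hx)⟩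
      have := mem_component_edgeSet (hE (Quotient.mk _ x')) (hEmem (Quotient.mk _ x'))
      rwa [Quotient.out_eq] at this
    · rintro ⟨C, rfl⟩
      exact ⟨⟨E C, hE C⟩, rfl⟩
  have := Fintype.ofFinite G.ConnectedComponent
  rw [hspan, finrank_span_eq_card hli, Nat.card_eq_fintype_card]

end

end Hypergraph

end

theorem proposition6p1 {k : Type*} [Field k] {α : Type*} (G : Hypergraph α)
    (hfin : G.vertexSet.Finite) (m : ℕ) (hm : 2 ≤ m) (hunif : G.IsUniform m)
    (hiso : ∀ x ∈ G.vertexSet, ¬ G.IsIsolated x)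
    (hconn : ∀ C : G.ConnectedComponent, (G.component C).IsProperlyConnected m)
    (n c p : ℕ) (hn : n = G.vertexSet.ncard) (hc : c = Nat.card G.ConnectedComponent)
    (hp : p = Nat.card G.PivotClass) :
    p ≤ n ∧ (G.edgeIdeal k).analyticSpread = ((n - p + c : ℕ) : WithBot ℕ∞) := by
  have : Finite G.vertexSet := hfin
  have : Finite G.edgeSet :=
    hfin.finite_subsets.subset fun e he => G.subset_vertexSet_of_mem_edgeSet he
  have hker := G.finrank_ker_pivotSum_add
  have hn' : n = Nat.card G.vertexSet := hn
  -- The rank formula `hker` gives `p ≤ n`, so the subtraction in `ℕ` is not truncated.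
  refine ⟨by omega, ?_⟩
  rw [G.edgeIdeal_eq_localMonomialIdeal k,
    MvPolynomial.analyticSpread_localMonomialIdeal (fun e : G.edgeSet => G.edgeExponent e)
      (by omega : 0 < m) fun e =>
      (G.degree_edgeExponent (G.subset_vertexSet_of_mem_edgeSet e.2)).trans (hunif e e.2).2]
  congr 2
  change Module.finrank ℚ G.edgeSpan = _
  rw [Hypergraph.finrank_edgeSpan_eq, Hypergraph.finrank_map_pivotSum_edgeSpan hm hunif hiso hconn]
  omega
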